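/- Notation. Let $h(t)=t\log_2\frac1t+(1-t)\log_2\frac1{1-t}$ be the binary entropy function. For real $q\ge 2$ and $0<x<\frac12$ let $\delta=\delta(q,x)\in[0,\frac12]$ be the unique solution of $$x=\Big(\tfrac12-\delta\Big)\cdot\frac{(1-\delta)^{q-1}-\delta^{q-1}}{(1-\delta)^q+\delta^q},$$ and put $$\psi(q,x)=(q-1)+\log_2\big((1-\delta)^q+\delta^q\big)-\tfrac q2\,h(x)-q\,x\log_2(1-2\delta).$$ For $0<\gamma<\frac12$, $0<\lambda<h(\gamma)$ and a positive integer $n$ such that $\lambda n$ is an integer and $i=\gamma n$ is an even integer, let $M$ be a uniformly random binary matrix with $\lambda n$ rows and $n$ columns, let $C=\{x\in\{0,1\}^n: Mx=0\}$ (over $\mathbb F_2$), let $X$ be the number of words of Hamming weight $i$ in $C$, and put $p=2^{-\lambda n}$. Proposition. For every $\varepsilon>0$ there are constants $c_\varepsilon>0$ and $C_\varepsilon>0$ and a function $\theta_\varepsilon:\mathbb N\to\mathbb R$ with $\theta_\varepsilon(n)=o(n)$ as $n\to\infty$, all three depending only on $\varepsilon$, such that for all $\gamma,\lambda,n$ as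 above with $\min\{\lambda,h(\gamma)-\lambda\}=\varepsilon$, and for every integer $k$ with $C_\varepsilon\le k\le c_\varepsilon n$, $$\mathbb E_C\,(X-\mathbb E X)^k\;\le\;2^{\theta_\varepsilon(n)}\cdot p^{\,k-1}\cdot 2^{\left(\psi(k,\gamma)+\frac k2 h(\gamma)\right)n}.$$ -/

import Mathlib

open scoped BigOperators Matrix

/-- The binary entropy function, with logarithms to base `2`. -/
noncomputable def entropyTwo (t : ℝ) : ℝ :=
  t * Real.logb 2 (1 / t) + (1 - t) * Real.logb 2 (1 / (1 - t))

/-- The set of all vectors of Hamming weight `i` in `{0,1}^n`. -/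
def weightLayer (n i : ℕ) : Set (Fin n → ZMod 2) :=
  {x | hammingNorm x = i}

/-- The binary linear code with parity check matrix `M`. -/
def parityCheckCode {m n : ℕ} (M : Matrix (Fin m) (Fin n) (ZMod 2)) :
    Submodule (ZMod 2) (Fin n → ZMod 2) :=
  LinearMap.ker M.mulVecLin

/-- The number of codewords of weight `i` in the code with parity check matrix `M`. -/
noncomputable def weightCount {m n : ℕ} (i : ℕ) (M : Matrix (Fin m) (Fin n) (ZMod 2)) : ℝ :=
  ((weightLayer n i ∩ (parityCheckCode M : Set (Fin n → ZMod 2))).ncard : ℝ)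

/-- The `k`-th central moment `E (X - E X)^k` of the number `X` of codewords of weight `i` in the
code whose `m × n` parity check matrix is uniformly random (`𝔼` is the average over all such
matrices). -/
noncomputable def centralMoment (m n i k : ℕ) : ℝ :=
  𝔼 M : Matrix (Fin m) (Fin n) (ZMod 2),
    (weightCount i M - 𝔼 M' : Matrix (Fin m) (Fin n) (ZMod 2), weightCount i M') ^ k

/-- The auxiliary function of `δ` whose inverse enters the definition of `psi`. -/
noncomputable def psiParam (p δ : ℝ) : ℝ :=
  (1 / 2 - δ) * (((1 - δ) ^ (p - 1) - δ ^ (p - 1)) / ((1 - δ) ^ p + δ ^ p))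

/-- For `p ≥ 2` and `0 < x < 1/2` the equation `psiParam p δ = x` has exactly one solution
in `[0, 1/2]`. -/
theorem existsUnique_psiParam {p x : ℝ} (hp : 2 ≤ p) (hx : 0 < x) (hx2 : x < 1 / 2) :
    ∃! δ : ℝ, (0 ≤ δ ∧ δ ≤ 1 / 2) ∧ psiParam p δ = x := by
  have hden : ∀ δ : ℝ, 0 ≤ δ → δ ≤ 1 / 2 → 0 < (1 - δ) ^ p + δ ^ p := fun δ h0 h1 =>
    add_pos_of_pos_of_nonneg (Real.rpow_pos_of_pos (by linarith) _) (Real.rpow_nonneg h0 _)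
  have hcont : ContinuousOn (psiParam p) (Set.Icc 0 (1 / 2)) := by
    unfold psiParam
    have hc1 : Continuous fun δ : ℝ => δ ^ (p - 1) := Real.continuous_rpow_const (by linarith)
    have hc2 : Continuous fun δ : ℝ => δ ^ p := Real.continuous_rpow_const (by linarith)
    have hs : Continuous fun δ : ℝ => 1 - δ := by fun_prop
    refine ContinuousOn.mul (by fun_prop) (ContinuousOn.div ?_ ?_ ?_)
    · exact ((hc1.comp hs).sub hc1).continuousOn
    · exact ((hc2.comp hs).add hc2).continuousOn
    · exact fun δ hδ => (hden δ hδ.1 hδ.2).ne'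
  have h0 : psiParam p 0 = 1 / 2 := by
    simp [psiParam, Real.zero_rpow (show p ≠ 0 by linarith),
      Real.zero_rpow (show p - 1 ≠ 0 by linarith)]
  have h1 : psiParam p (1 / 2) = 0 := by simp [psiParam]
  have hanti : StrictAntiOn (psiParam p) (Set.Icc 0 (1 / 2)) := by
    have key : ∀ δ : ℝ, 0 ≤ δ → δ ≤ 1 / 2 → psiParam p δ =
        (1 - δ / (1 - δ)) * (1 - (δ / (1 - δ)) ^ (p - 1)) / (2 * (1 + (δ / (1 - δ)) ^ p)) := by
      intro δ hδ0 hδ1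
      have hb : 0 < 1 - δ := by linarith
      have hbp : 0 < (1 - δ) ^ (p - 1) := Real.rpow_pos_of_pos hb _
      have e : (1 - δ) ^ p = (1 - δ) ^ (p - 1) * (1 - δ) := by
        rw [← Real.rpow_add_one hb.ne']; congr 1; ring
      have hd := hden δ hδ0 hδ1
      rw [psiParam, Real.div_rpow hδ0 hb.le, Real.div_rpow hδ0 hb.le]
      rw [e] at hd ⊢
      have hd' : (1 - δ) ^ (p - 1) * (1 - δ) + δ ^ p ≠ 0 := hd.ne'
      field_simp
      ring
    intro a ha b hb hab
    have ha1 : 0 < 1 - a := by linarith [ha.2]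
    have hb1 : 0 < 1 - b := by linarith [hb.2]
    rw [key a ha.1 ha.2, key b hb.1 hb.2]
    set s := a / (1 - a) with hs
    set t := b / (1 - b) with ht
    have hs0 : 0 ≤ s := div_nonneg ha.1 ha1.le
    have hst : s < t := by
      rw [hs, ht, div_lt_div_iff₀ ha1 hb1]; nlinarith
    have ht1 : t ≤ 1 := by
      rw [ht, div_le_one hb1]; linarith [hb.2]
    have e1 : s ^ (p - 1) < t ^ (p - 1) := Real.rpow_lt_rpow hs0 hst (by linarith)
    have e2 : s ^ p ≤ t ^ p := Real.rpow_le_rpow hs0 hst.le (by linarith)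
    have e3 : t ^ (p - 1) ≤ 1 := Real.rpow_le_one (hs0.trans hst.le) ht1 (by linarith)
    have e4 : 0 ≤ s ^ p := Real.rpow_nonneg hs0 _
    apply div_lt_div₀ _ (by linarith) _ (by linarith)
    · apply mul_lt_mul'' (by linarith) (by linarith) (by linarith) (by linarith)
    · exact mul_nonneg (by linarith) (by linarith)
  have hmem : x ∈ psiParam p '' Set.Icc 0 (1 / 2) := by
    apply intermediate_value_Icc' (by norm_num) hcont
    rw [h0, h1]
    exact ⟨hx.le, hx2.le⟩
  obtain ⟨δ, hδ, hδx⟩ := hmem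
  exact ⟨δ, ⟨hδ, hδx⟩, fun δ' h' => hanti.injOn h'.1 hδ (h'.2.trans hδx.symm)⟩

/-- The solution `δ ∈ [0, 1/2]` of
`x = (1/2 - δ) * ((1-δ)^(p-1) - δ^(p-1)) / ((1-δ)^p + δ^p)`. -/
noncomputable def psiDelta (p x : ℝ) : ℝ :=
  Classical.epsilon fun δ : ℝ => (0 ≤ δ ∧ δ ≤ 1 / 2) ∧ psiParam p δ = x

theorem psiDelta_spec {p x : ℝ} (hp : 2 ≤ p) (hx : 0 < x) (hx2 : x < 1 / 2) :
    (0 ≤ psiDelta p x ∧ psiDelta p x ≤ 1 / 2) ∧ psiParam p (psiDelta p x) = x :=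
  Classical.epsilon_spec (existsUnique_psiParam hp hx hx2).exists

/-- The exponent `ψ(p, x)`, for `p ≥ 2` and `0 < x < 1/2`, that governs the `p`-th norm of
the Krawchouk polynomial of degree `x * n` on `{0,1}^n`. -/
noncomputable def psi (p x : ℝ) : ℝ :=
  (p - 1) + Real.logb 2 ((1 - psiDelta p x) ^ p + psiDelta p x ^ p) - p / 2 * entropyTwo x
    - p * x * Real.logb 2 (1 - 2 * psiDelta p x)

/-! Expand the condition `M v = 0` in characters indexed by `u`. The term `u = 0` is the mean, and
averaging the `k`-th power of the rest over `M` gives `p ^ k` times the number of pairs of tuples,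
with `u_j` nonzero and `v_j` of weight `i`, such that `∑ u_j ⊗ v_j = 0` (`centralMoment_eq`). Group
these pairs by the tuple `U` of the `u_j`.

If `U` is constant, the `v_j` must sum to zero. A Chernoff bound with parameter `1 - 2δ` bounds the
number of such families by the target exponential; there are at most `2 ^ m` constant tuples, so one
factor `p` is lost.

If `U` has rank `d ≥ 2`, there are at most `2 ^ (k d + m d)` such tuples. For small `d`, pigeonhole
yields a large block of equal `u_j`. The sum constraint on that block saves nearly `2 ^ n`, and each
further rank saves a factor `|L|`, where `L` is the weight layer (`relationCount_le`). For large
`d`, the saving `|L| ^ d` suffices alone, since the entropy exceeds `λ` by at least `ε`. These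
contributions sum geometrically to a multiple of `2 ^ m * 2 ^ (h k n - n)`, which
`two_rpow_le_two_rpow_psi` compares with the target. -/

/-! ### Character sums over `ZMod 2` and over matrices. -/

/-- The nontrivial character of `ZMod 2`, with real values. -/
noncomputable def signTwo (x : ZMod 2) : ℝ := if x = 0 then 1 else -1

theorem zmod_two_eq : ∀ x : ZMod 2, x = 0 ∨ x = 1 := by decide

theorem signTwo_zero : signTwo 0 = 1 := by simp [signTwo]

theorem signTwo_one : signTwo 1 = -1 := by simp [signTwo]

theorem signTwo_add (x y : ZMod 2) : signTwo (x + y) = signTwo x * signTwo y := by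
  have h2 : (1 : ZMod 2) + 1 = 0 := by decide
  rcases zmod_two_eq x with rfl | rfl <;> rcases zmod_two_eq y with rfl | rfl <;>
    simp [signTwo, h2]

theorem signTwo_sum {ι : Type*} (s : Finset ι) (f : ι → ZMod 2) :
    signTwo (∑ i ∈ s, f i) = ∏ i ∈ s, signTwo (f i) := by
  classical
  induction s using Finset.induction_on with
  | empty => simp [signTwo_zero]
  | insert a s ha ih => rw [Finset.sum_insert ha, Finset.prod_insert ha, signTwo_add, ih]

theorem sum_zmod_two {M : Type*} [AddCommMonoid M] (f : ZMod 2 → M) :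
    ∑ x, f x = f 0 + f 1 := Fin.sum_univ_two f

theorem sum_pi_prod {ι κ : Type*} [Fintype ι] [DecidableEq ι] [Fintype κ] (g : ι → κ → ℝ) :
    ∑ x : ι → κ, ∏ i, g i (x i) = ∏ i, ∑ y, g i y := by
  rw [Finset.prod_univ_sum, Fintype.piFinset_univ]

theorem sum_signTwo_dotProduct {ι : Type*} [Fintype ι] [DecidableEq ι] (w : ι → ZMod 2) :
    ∑ u : ι → ZMod 2, signTwo (u ⬝ᵥ w) = if w = 0 then 2 ^ Fintype.card ι else 0 := by
  have h : ∀ a : ZMod 2, ∑ y, signTwo (y * a) = if a = 0 then 2 else 0 := by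
    intro a
    rw [sum_zmod_two]
    rcases zmod_two_eq a with rfl | rfl <;> norm_num [signTwo]
  simp only [dotProduct, signTwo_sum]
  rw [sum_pi_prod fun i y => signTwo (y * w i)]
  simp only [h]
  split_ifs with hw
  · simp [hw]
  · obtain ⟨i, hi⟩ := Function.ne_iff.1 hw
    exact Finset.prod_eq_zero (Finset.mem_univ i) (by simpa using hi)

theorem sum_signTwo_matrix {m n : ℕ} (Y : Matrix (Fin m) (Fin n) (ZMod 2)) :
    ∑ M : Matrix (Fin m) (Fin n) (ZMod 2), signTwo (∑ a, M a ⬝ᵥ Y a) =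
      if Y = 0 then 2 ^ (m * n) else 0 := by
  simp only [signTwo_sum]
  have := sum_pi_prod (ι := Fin m) (κ := Fin n → ZMod 2) fun a r => signTwo (r ⬝ᵥ Y a)
  refine Eq.trans this ?_
  simp only [sum_signTwo_dotProduct]
  split_ifs with hY
  · have h0 : ∀ x, Y x = 0 := fun x => congrFun hY x
    simp [h0, ← pow_mul, mul_comm]
  · obtain ⟨i, hi⟩ := Function.ne_iff.1 hY
    exact Finset.prod_eq_zero (Finset.mem_univ i) (if_neg hi)

theorem expect_signTwo_matrix {m n : ℕ} (Y : Matrix (Fin m) (Fin n) (ZMod 2)) :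
    𝔼 M : Matrix (Fin m) (Fin n) (ZMod 2), signTwo (∑ a, M a ⬝ᵥ Y a) =
      if Y = 0 then 1 else 0 := by
  have hc : Fintype.card (Matrix (Fin m) (Fin n) (ZMod 2)) = 2 ^ (m * n) := by
    refine (Fintype.card_fun (α := Fin m) (β := Fin n → ZMod 2)).trans ?_
    simp [← pow_mul, mul_comm]
  rw [Fintype.expect_eq_sum_div_card, sum_signTwo_matrix, hc]
  split_ifs <;> simp

/-- The vectors of Hamming weight `i` in `{0,1}^n`, as a finite set. -/
def weightFinset (n i : ℕ) : Finset (Fin n → ZMod 2) := {v | hammingNorm v = i}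

theorem mem_weightFinset {n i : ℕ} {v : Fin n → ZMod 2} :
    v ∈ weightFinset n i ↔ hammingNorm v = i := by simp [weightFinset]

theorem weightCount_eq_sum {m n : ℕ} (i : ℕ) (M : Matrix (Fin m) (Fin n) (ZMod 2)) :
    weightCount i M = (2 ^ m : ℝ)⁻¹ *
      ∑ u : Fin m → ZMod 2, ∑ v ∈ weightFinset n i, signTwo (u ⬝ᵥ M *ᵥ v) := by
  classical
  rw [Finset.sum_comm]
  simp only [sum_signTwo_dotProduct, Fintype.card_fin]
  have h : weightLayer n i ∩ (parityCheckCode M : Set (Fin n → ZMod 2)) =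
      ((weightFinset n i).filter fun v => M *ᵥ v = 0 : Finset (Fin n → ZMod 2)) := by
    ext v
    simp [weightLayer, weightFinset, parityCheckCode]
  rw [weightCount, h, Set.ncard_coe_finset, ← Finset.sum_filter, Finset.sum_const, nsmul_eq_mul]
  field_simp

theorem dotProduct_mulVec_eq {m n : ℕ} (M : Matrix (Fin m) (Fin n) (ZMod 2))
    (u : Fin m → ZMod 2) (v : Fin n → ZMod 2) :
    u ⬝ᵥ M *ᵥ v = ∑ a, M a ⬝ᵥ (Matrix.vecMulVec u v) a := by
  simp only [dotProduct, Matrix.mulVec, Matrix.vecMulVec_apply, Finset.mul_sum]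
  exact Finset.sum_congr rfl fun a _ => Finset.sum_congr rfl fun b _ => by ring

/-- The mean is exactly the term `u = 0`: for `u ≠ 0` and `v ≠ 0` the matrix `u vᵀ` is nonzero, so
its character averages to zero. Positivity of `i` excludes `v = 0`. -/
theorem weightCount_sub_expect {m n i : ℕ} (hi : 0 < i) (M : Matrix (Fin m) (Fin n) (ZMod 2)) :
    weightCount i M - 𝔼 M' : Matrix (Fin m) (Fin n) (ZMod 2), weightCount i M' =
      (2 ^ m : ℝ)⁻¹ * ∑ u ∈ Finset.univ.erase (0 : Fin m → ZMod 2),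
        ∑ v ∈ weightFinset n i, signTwo (u ⬝ᵥ M *ᵥ v) := by
  classical
  have hE : 𝔼 M' : Matrix (Fin m) (Fin n) (ZMod 2), weightCount i M' =
      (2 ^ m : ℝ)⁻¹ * ∑ v ∈ weightFinset n i, signTwo ((0 : Fin m → ZMod 2) ⬝ᵥ M *ᵥ v) := by
    simp only [weightCount_eq_sum, ← Finset.mul_expect, Finset.expect_sum_comm]
    congr 1
    rw [← Finset.add_sum_erase _ _ (Finset.mem_univ (0 : Fin m → ZMod 2))]
    simp only [dotProduct_mulVec_eq, expect_signTwo_matrix]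
    rw [Finset.sum_eq_zero (s := Finset.univ.erase (0 : Fin m → ZMod 2)), add_zero]
    · refine Finset.sum_congr rfl fun v _ => ?_
      rw [if_pos (by ext; simp [Matrix.vecMulVec_apply]), ← dotProduct_mulVec_eq,
        zero_dotProduct, signTwo_zero]
    · intro u hu
      refine Finset.sum_eq_zero fun v hv => if_neg fun h => ?_
      obtain ⟨a, ha⟩ := Function.ne_iff.1 (Finset.ne_of_mem_erase hu)
      have hv0 : v ≠ 0 := by
        rintro rfl
        rw [mem_weightFinset, hammingNorm_zero] at hv
        omega
      obtain ⟨b, hb⟩ := Function.ne_iff.1 hv0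
      exact mul_ne_zero ha hb (congrFun (congrFun h a) b)
  rw [hE, weightCount_eq_sum, ← mul_sub,
    ← Finset.add_sum_erase _ _ (Finset.mem_univ (0 : Fin m → ZMod 2))]
  ring

/-! ### Central moments as counts of linear relations. -/

/-- The number of families of vectors `V j ∈ L` all of whose columns are linear relations
between the vectors `U j`. -/
def relationCount {κ E : Type*} [Fintype κ] [DecidableEq κ] [AddCommGroup E] [Module (ZMod 2) E]
    [DecidableEq E] {n : ℕ} (L : Finset (Fin n → ZMod 2)) (U : κ → E) : ℕ :=
  ((Fintype.piFinset fun _ : κ => L).filter fun V => ∀ b, ∑ j, V j b • U j = 0).card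

theorem centralMoment_eq {m n i k : ℕ} (hi : 0 < i) :
    centralMoment m n i k = ((2 ^ m : ℝ)⁻¹) ^ k *
      ∑ U ∈ Fintype.piFinset fun _ : Fin k => Finset.univ.erase (0 : Fin m → ZMod 2),
        (relationCount (weightFinset n i) U : ℝ) := by
  classical
  have hpow : ∀ M : Matrix (Fin m) (Fin n) (ZMod 2),
      (∑ u ∈ Finset.univ.erase (0 : Fin m → ZMod 2),
        ∑ v ∈ weightFinset n i, signTwo (u ⬝ᵥ M *ᵥ v)) ^ k =
      ∑ U ∈ Fintype.piFinset fun _ : Fin k => Finset.univ.erase (0 : Fin m → ZMod 2),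
        ∑ V ∈ Fintype.piFinset fun _ : Fin k => weightFinset n i,
          signTwo (∑ a, M a ⬝ᵥ (∑ j, Matrix.vecMulVec (U j) (V j)) a) := by
    intro M
    have := Finset.prod_univ_sum (fun _ : Fin k => Finset.univ.erase (0 : Fin m → ZMod 2))
      (fun _ u => ∑ v ∈ weightFinset n i, signTwo (u ⬝ᵥ M *ᵥ v))
    rw [Finset.prod_const, Finset.card_univ, Fintype.card_fin] at this
    rw [this]
    refine Finset.sum_congr rfl fun U _ => ?_
    rw [Finset.prod_univ_sum]
    refine Finset.sum_congr rfl fun V _ => ?_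
    rw [← signTwo_sum]
    congr 1
    simp only [dotProduct_mulVec_eq]
    rw [Finset.sum_comm]
    refine Finset.sum_congr rfl fun a _ => ?_
    rw [← dotProduct_sum]
    congr 1
    ext b
    simp [Matrix.sum_apply, Finset.sum_apply]
  simp only [centralMoment, weightCount_sub_expect hi, mul_pow, ← Finset.mul_expect, hpow,
    Finset.expect_sum_comm, expect_signTwo_matrix]
  congr 1
  refine Finset.sum_congr rfl fun U _ => ?_
  rw [relationCount, Finset.card_filter]
  push_cast
  refine Finset.sum_congr rfl fun V _ => if_congr ?_ rfl rfl
  constructor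
  · intro h b
    ext a
    simpa [Matrix.sum_apply, Matrix.vecMulVec_apply, mul_comm] using congrFun (congrFun h a) b
  · intro h
    ext a b
    simpa [Matrix.sum_apply, Matrix.vecMulVec_apply, mul_comm] using congrFun (h b) a

/-! ### Linear algebra: rank, relations and repeated vectors. -/

theorem exists_basis_indices {κ E : Type*} [Fintype κ] [DecidableEq κ] [AddCommGroup E]
    [Module (ZMod 2) E] (U : κ → E) {j₀ : κ} (h0 : U j₀ ≠ 0) :
    ∃ J : Finset κ, j₀ ∈ J ∧ LinearIndepOn (ZMod 2) U (J : Set κ) ∧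
      J.card = Module.finrank (ZMod 2) (Submodule.span (ZMod 2) (Set.range U)) := by
  classical
  have hs : LinearIndepOn (ZMod 2) U {j₀} := LinearIndepOn.singleton h0
  obtain ⟨b, -, hb, hspan, hli⟩ := exists_linearIndepOn_extension hs (Set.subset_univ _)
  refine ⟨b.toFinset, by simpa using hb, by simpa using hli, ?_⟩
  have h1 : Submodule.span (ZMod 2) (Set.range U) = Submodule.span (ZMod 2) (U '' b) := by
    apply le_antisymm
    · rw [Submodule.span_le, ← Set.image_univ]
      exact hspan
    · exact Submodule.span_mono (Set.image_subset_range _ _)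
  have h2 := finrank_span_eq_card (R := ZMod 2) (b := fun x : b => U x) hli
  rw [← Set.image_eq_range] at h2
  rw [h1, h2, Set.toFinset_card]

/-- If `U` is constant on `A`, then at most `L.card ^ s` choices of the vectors outside `A` extend
to a family of relations, where `s` is the nullity of `U` modulo `u₀` on the complement of `A`. -/
theorem exists_relationCount_le {κ E : Type*} [Fintype κ] [DecidableEq κ] [AddCommGroup E]
    [Module (ZMod 2) E] [DecidableEq E] {n : ℕ} (L : Finset (Fin n → ZMod 2)) (U : κ → E)
    {A : Finset κ} {u₀ : E} (hu₀ : u₀ ≠ 0) (hA : ∀ j ∈ A, U j = u₀) (hne : A.Nonempty) {W : ℕ}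
    (hW : ∀ w : Fin n → ZMod 2,
      ((Fintype.piFinset fun _ : A => L).filter fun V => ∑ j, V j = w).card ≤ W) :
    ∃ s : ℕ, s + A.card + Module.finrank (ZMod 2) (Submodule.span (ZMod 2) (Set.range U)) =
      Fintype.card κ + 1 ∧ relationCount L U ≤ W * L.card ^ s := by
  classical
  obtain ⟨j₀, hj₀⟩ := hne
  obtain ⟨J, hJ0, hJ, hJc⟩ := exists_basis_indices U (j₀ := j₀) (by rwa [hA _ hj₀])
  -- `U` is constant on `A` but injective on the independent set `J`.
  have hAJ : A ∩ J = {j₀} := by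
    ext j
    simp only [Finset.mem_inter, Finset.mem_singleton]
    constructor
    · rintro ⟨h1, h2⟩
      exact hJ.injOn h2 hJ0 (by rw [hA _ h1, hA _ hj₀])
    · rintro rfl
      exact ⟨hj₀, hJ0⟩
  -- Applied to the difference of two relations that agree off `A ∪ J`. Collapsing `A` onto the
  -- index `j₀` turns it into a relation among the independent `U j`, `j ∈ J`, so all its
  -- coefficients vanish.
  have key : ∀ D : κ → ZMod 2, (∀ j, j ∉ A ∪ J → D j = 0) → ∑ j, D j • U j = 0 →
      ∑ j ∈ A, D j = 0 ∧ ∀ j ∈ J, j ≠ j₀ → D j = 0 := by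
    intro D hD0 hD
    have hsplit : ∑ j, D j • U j = (∑ j ∈ A, D j) • u₀ + ∑ j ∈ J.erase j₀, D j • U j := by
      have hd : Disjoint A (J.erase j₀) := by
        rw [Finset.disjoint_left]
        intro j h1 h2
        have : j ∈ A ∩ J := Finset.mem_inter.2 ⟨h1, Finset.mem_of_mem_erase h2⟩
        rw [hAJ, Finset.mem_singleton] at this
        exact Finset.ne_of_mem_erase h2 this
      have h1 : ∑ j ∈ A, D j • u₀ = ∑ j ∈ A, D j • U j :=
        Finset.sum_congr rfl fun j hj => by rw [hA j hj]
      rw [Finset.sum_smul, h1, ← Finset.sum_union hd]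
      symm
      refine Finset.sum_subset (Finset.subset_univ _) fun j _ hj => ?_
      rw [hD0 j, zero_smul]
      intro h
      apply hj
      rcases Finset.mem_union.1 h with h | h
      · exact Finset.mem_union_left _ h
      · by_cases hjj : j = j₀
        · exact Finset.mem_union_left _ (hjj ▸ hj₀)
        · exact Finset.mem_union_right _ (Finset.mem_erase.2 ⟨hjj, h⟩)
    rw [hsplit] at hD
    have := (linearIndepOn_finset_iff.1 hJ)
      (fun j => if j = j₀ then ∑ j ∈ A, D j else D j) (by
        rw [← Finset.add_sum_erase _ _ hJ0]
        simp only [if_true]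
        rw [hA _ hj₀, ← hD]
        congr 1
        exact Finset.sum_congr rfl fun j hj => by rw [if_neg (Finset.ne_of_mem_erase hj)])
    refine ⟨by simpa using this j₀ hJ0, fun j hj hne => by simpa [hne] using this j hj⟩
  refine ⟨((A ∪ J)ᶜ).card, ?_, ?_⟩
  · have h1 := Finset.card_union_add_card_inter A J
    have h2 := Finset.card_compl_add_card (A ∪ J)
    rw [hAJ, Finset.card_singleton] at h1
    omega
  · have hcard : L.card ^ ((A ∪ J)ᶜ).card =
        (Fintype.piFinset fun _ : ((A ∪ J)ᶜ : Finset κ) => L).card := by simp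
    rw [hcard]
    refine Finset.card_le_mul_card_image_of_maps_to
      (f := fun V (j : ((A ∪ J)ᶜ : Finset κ)) => V j) ?_ W ?_
    · intro V hV
      rw [Fintype.mem_piFinset]
      intro j
      exact Fintype.mem_piFinset.1 (Finset.mem_filter.1 hV).1 _
    · intro g _
      rcases Finset.eq_empty_or_nonempty
        (((Fintype.piFinset fun _ : κ => L).filter fun V => ∀ b, ∑ j, V j b • U j = 0).filter
          fun V => (fun j : ((A ∪ J)ᶜ : Finset κ) => V j) = g) with he | ⟨V₀, hV₀⟩
      · rw [he]; simp
      have hdiff : ∀ V V' : κ → Fin n → ZMod 2,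
          ((∀ b, ∑ j, V j b • U j = 0) ∧ (fun j : ((A ∪ J)ᶜ : Finset κ) => V j) = g) →
          ((∀ b, ∑ j, V' j b • U j = 0) ∧ (fun j : ((A ∪ J)ᶜ : Finset κ) => V' j) = g) →
          ∀ b, ∑ j ∈ A, (V j b - V' j b) = 0 ∧ ∀ j ∈ J, j ≠ j₀ → V j b - V' j b = 0 := by
        intro V V' h h' b
        refine key (fun j => V j b - V' j b) (fun j hj => ?_) ?_
        · have := congrFun (h.2.trans h'.2.symm) ⟨j, Finset.mem_compl.2 hj⟩
          simp only at this
          rw [this, sub_self]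
        · simp only [sub_smul, Finset.sum_sub_distrib, h.1 b, h'.1 b, sub_zero]
      simp only [Finset.mem_filter, Fintype.mem_piFinset] at hV₀
      refine le_trans (Finset.card_le_card_of_injOn (fun V (j : A) => V j) ?_ ?_)
        (hW (∑ j ∈ A, V₀ j))
      · intro V hV
        simp only [Finset.coe_filter, Finset.mem_filter, Fintype.mem_piFinset,
          Set.mem_ofPred_eq] at hV ⊢
        refine ⟨fun j => hV.1.1 j, ?_⟩
        rw [Finset.sum_coe_sort A V]
        ext b
        have := (hdiff V V₀ ⟨hV.1.2, hV.2⟩ ⟨hV₀.1.2, hV₀.2⟩ b).1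
        rw [Finset.sum_sub_distrib, sub_eq_zero] at this
        simpa using this
      · intro V hV V' hV' hVV'
        simp only [Finset.coe_filter, Finset.mem_filter, Fintype.mem_piFinset,
          Set.mem_ofPred_eq] at hV hV'
        ext j b
        by_cases hjA : j ∈ A
        · exact congrFun (congrFun hVV' ⟨j, hjA⟩) b
        by_cases hjJ : j ∈ J
        · exact sub_eq_zero.1 ((hdiff V V' ⟨hV.1.2, hV.2⟩ ⟨hV'.1.2, hV'.2⟩ b).2 j hjJ
            fun h => hjA (h ▸ hj₀))
        · exact congrFun (congrFun (hV.2.trans hV'.2.symm) ⟨j, by simp [hjA, hjJ]⟩) b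

/-- A rank-`d` family is determined by a basis of its span, `d` vectors of `E`, and by `d` binary
coordinates for each member. -/
theorem card_filter_finrank_span_le {κ E : Type*} [Fintype κ] [DecidableEq κ] [AddCommGroup E]
    [Module (ZMod 2) E] [Fintype E] [DecidableEq E] (d : ℕ) :
    (Finset.univ.filter fun U : κ → E =>
      Module.finrank (ZMod 2) (Submodule.span (ZMod 2) (Set.range U)) = d).card ≤
      2 ^ (Fintype.card κ * d) * Fintype.card E ^ d := by
  classical
  have h : (Finset.univ.filter fun U : κ → E =>
      Module.finrank (ZMod 2) (Submodule.span (ZMod 2) (Set.range U)) = d) ⊆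
      Finset.univ.image fun PQ : (κ → Fin d → ZMod 2) × (Fin d → E) =>
        fun j => ∑ t, PQ.1 j t • PQ.2 t := by
    intro U hU
    rw [Finset.mem_filter] at hU
    let b := Module.finBasisOfFinrankEq (ZMod 2) _ hU.2
    refine Finset.mem_image.2 ⟨⟨fun j t => b.repr ⟨U j, Submodule.subset_span ⟨j, rfl⟩⟩ t,
      fun t => (b t : E)⟩, Finset.mem_univ _, ?_⟩
    ext j
    have := congrArg (Submodule.subtype _) (b.sum_repr ⟨U j, Submodule.subset_span ⟨j, rfl⟩⟩)
    rw [map_sum] at this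
    simpa only [map_smul, Submodule.subtype_apply] using this
  refine (Finset.card_le_card h).trans (Finset.card_image_le.trans ?_)
  simp [← pow_mul, mul_comm]

theorem one_lt_finrank_span_of_ne {κ E : Type*} [Fintype κ] [AddCommGroup E]
    [Module (ZMod 2) E] {U : κ → E} (h0 : ∀ j, U j ≠ 0) {i j : κ} (hij : U i ≠ U j) :
    1 < Module.finrank (ZMod 2) (Submodule.span (ZMod 2) (Set.range U)) := by
  have := FiniteDimensional.span_of_finite (ZMod 2) (Set.finite_range U)
  by_contra! h
  obtain ⟨v, hv⟩ := finrank_le_one_iff.1 h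
  obtain ⟨a, ha⟩ := hv ⟨U i, Submodule.subset_span ⟨i, rfl⟩⟩
  obtain ⟨b, hb⟩ := hv ⟨U j, Submodule.subset_span ⟨j, rfl⟩⟩
  have ha' : a • (v : E) = U i := congrArg Subtype.val ha
  have hb' : b • (v : E) = U j := congrArg Subtype.val hb
  rcases zmod_two_eq a with rfl | rfl
  · exact h0 i (by rw [← ha', zero_smul])
  rcases zmod_two_eq b with rfl | rfl
  · exact h0 j (by rw [← hb', zero_smul])
  · exact hij (ha'.symm.trans hb')

theorem exists_le_card_fiber_of_finrank_span {κ E : Type*} [Fintype κ] [Nonempty κ]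
    [AddCommGroup E] [Module (ZMod 2) E] [DecidableEq E] (U : κ → E) {T : ℕ}
    (hT : 2 ^ Module.finrank (ZMod 2) (Submodule.span (ZMod 2) (Set.range U)) * T ≤
      Fintype.card κ) :
    ∃ j₀, T ≤ (Finset.univ.filter fun j => U j = U j₀).card := by
  classical
  have := FiniteDimensional.span_of_finite (ZMod 2) (Set.finite_range U)
  have : Finite (Submodule.span (ZMod 2) (Set.range U)) :=
    Module.finite_of_finite (ZMod 2)
  have := Fintype.ofFinite (Submodule.span (ZMod 2) (Set.range U))
  have hcard := Module.card_eq_pow_finrank (K := ZMod 2)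
    (V := Submodule.span (ZMod 2) (Set.range U))
  rw [ZMod.card] at hcard
  rw [← hcard] at hT
  have himg : (Finset.univ.image U).card ≤
      Fintype.card (Submodule.span (ZMod 2) (Set.range U)) := by
    rw [← Fintype.card_coe]
    refine Fintype.card_le_of_injective (fun x => ⟨x, ?_⟩) fun x y h => ?_
    · obtain ⟨j, -, hj⟩ := Finset.mem_image.1 x.2
      exact Submodule.subset_span ⟨j, hj⟩
    · exact Subtype.ext (by simpa using h)
  obtain ⟨y, hy, hle⟩ := Finset.exists_le_card_fiber_of_mul_le_card_of_maps_to
    (s := Finset.univ) (t := Finset.univ.image U) (f := U)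
    (fun j hj => Finset.mem_image_of_mem U hj) (by simp)
    ((Nat.mul_le_mul_right T himg).trans hT)
  obtain ⟨j₀, -, rfl⟩ := Finset.mem_image.1 hy
  exact ⟨j₀, hle⟩

/-! ### Generating-function bounds for vectors of fixed weight. -/

theorem pow_hammingNorm_eq_prod {n : ℕ} (θ : ℝ) (v : Fin n → ZMod 2) :
    θ ^ hammingNorm v = ∏ b, if v b = 0 then 1 else θ := by
  simp [hammingNorm, Finset.prod_ite]

/-- Write the parity indicator as the average of two characters; each half factors over coordinates.
The sign of the `(1 - θ)` term depends on `s`, and even parity is the worst case. -/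
theorem sum_parity_weight_le {α : Type*} [Fintype α] [DecidableEq α] {θ : ℝ} (h1 : θ ≤ 1)
    (s : ZMod 2) :
    ∑ c : α → ZMod 2, (if ∑ j, c j = s then ∏ j, (if c j = 0 then 1 else θ) else 0) ≤
      ((1 + θ) ^ Fintype.card α + (1 - θ) ^ Fintype.card α) / 2 := by
  have hind : ∀ x : ZMod 2, (if x = s then (1 : ℝ) else 0) = (1 + signTwo s * signTwo x) / 2 := by
    intro x
    rcases zmod_two_eq s with rfl | rfl <;> rcases zmod_two_eq x with rfl | rfl <;>
      norm_num [signTwo]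
  have hs : signTwo s ≤ 1 := by
    unfold signTwo; split_ifs <;> norm_num
  have hterm : ∀ c : α → ZMod 2,
      (if ∑ j, c j = s then ∏ j, (if c j = 0 then 1 else θ) else 0) =
      (∏ j, (if c j = 0 then 1 else θ)) / 2 +
        signTwo s / 2 * ∏ j, (signTwo (c j) * if c j = 0 then 1 else θ) := by
    intro c
    rw [Finset.prod_mul_distrib, ← signTwo_sum]
    have := hind (∑ j, c j)
    split_ifs at this ⊢ with h
    · linear_combination (∏ j, (if c j = 0 then 1 else θ)) * this
    · linear_combination (∏ j, (if c j = 0 then 1 else θ)) * this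
  have e1 := sum_pi_prod (ι := α) (κ := ZMod 2) fun _ x => if x = 0 then (1 : ℝ) else θ
  have e2 := sum_pi_prod (ι := α) (κ := ZMod 2) fun _ x => signTwo x * if x = 0 then (1 : ℝ) else θ
  simp only [sum_zmod_two, Finset.prod_const, Finset.card_univ, signTwo_zero, signTwo_one,
    if_true, one_ne_zero, if_false] at e1 e2
  simp only [hterm, Finset.sum_add_distrib, ← Finset.mul_sum, ← Finset.sum_div]
  rw [e1, e2]
  have hp : 0 ≤ (1 - θ) ^ Fintype.card α := pow_nonneg (by linarith) _
  have : (1 * 1 + -1 * θ) = 1 - θ := by ring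
  rw [this]
  nlinarith [mul_le_mul_of_nonneg_right hs hp]

/-- Chernoff's method: give each entry `1` the weight `θ`, drop the weight constraint, and use that
the sum constraint acts on each of the `n` columns separately. -/
theorem card_filter_sum_eq_mul_pow_le {α : Type*} [Fintype α] [DecidableEq α] {n i : ℕ} {θ : ℝ}
    (h0 : 0 ≤ θ) (h1 : θ ≤ 1) (w : Fin n → ZMod 2) :
    (((Fintype.piFinset fun _ : α => weightFinset n i).filter fun V => ∑ j, V j = w).card : ℝ) *
      θ ^ (i * Fintype.card α) ≤
      (((1 + θ) ^ Fintype.card α + (1 - θ) ^ Fintype.card α) / 2) ^ n := by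
  have hw0 : ∀ x : ZMod 2, 0 ≤ if x = 0 then (1 : ℝ) else θ := by
    intro x; split_ifs <;> linarith
  calc _ = ∑ V ∈ (Fintype.piFinset fun _ : α => weightFinset n i).filter fun V => ∑ j, V j = w,
          ∏ j, ∏ b, (if V j b = 0 then 1 else θ) := by
        rw [← nsmul_eq_mul, ← Finset.sum_const]
        refine Finset.sum_congr rfl fun V hV => ?_
        rw [Finset.mem_filter, Fintype.mem_piFinset] at hV
        rw [pow_mul, ← Finset.card_univ, ← Finset.prod_const]
        refine Finset.prod_congr rfl fun j _ => ?_
        rw [← pow_hammingNorm_eq_prod, mem_weightFinset.1 (hV.1 j)]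
    _ ≤ ∑ V ∈ Finset.univ.filter fun V : α → Fin n → ZMod 2 => ∑ j, V j = w,
          ∏ j, ∏ b, (if V j b = 0 then 1 else θ) := by
        refine Finset.sum_le_sum_of_subset_of_nonneg
          (Finset.filter_subset_filter _ (Finset.subset_univ _)) fun V _ _ => ?_
        exact Finset.prod_nonneg fun j _ => Finset.prod_nonneg fun b _ => hw0 _
    _ = ∑ V : α → Fin n → ZMod 2, ∏ b,
          (if ∑ j, V j b = w b then ∏ j, (if V j b = 0 then 1 else θ) else 0) := by
        rw [Finset.sum_filter]
        refine Finset.sum_congr rfl fun V _ => ?_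
        split_ifs with h
        · rw [Finset.prod_comm]
          refine Finset.prod_congr rfl fun b _ => ?_
          rw [if_pos]
          rw [← h, Finset.sum_apply]
        · obtain ⟨b, hb⟩ := Function.ne_iff.1 h
          rw [Finset.sum_apply] at hb
          exact (Finset.prod_eq_zero (Finset.mem_univ b) (if_neg hb)).symm
    _ = ∑ V : Fin n → α → ZMod 2, ∏ b,
          (if ∑ j, V b j = w b then ∏ j, (if V b j = 0 then 1 else θ) else 0) :=
        Fintype.sum_equiv (Equiv.piComm fun _ _ => ZMod 2) _ _ fun V => rfl
    _ = ∏ b, ∑ c : α → ZMod 2,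
          (if ∑ j, c j = w b then ∏ j, (if c j = 0 then 1 else θ) else 0) :=
        sum_pi_prod fun b (c : α → ZMod 2) =>
          if ∑ j, c j = w b then ∏ j, (if c j = 0 then (1 : ℝ) else θ) else 0
    _ ≤ ∏ _b : Fin n, (((1 + θ) ^ Fintype.card α + (1 - θ) ^ Fintype.card α) / 2) := by
        refine Finset.prod_le_prod (fun b _ => ?_) fun b _ => sum_parity_weight_le h1 _
        refine Finset.sum_nonneg fun c _ => ?_
        split_ifs
        · exact Finset.prod_nonneg fun j _ => hw0 _
        · exact le_rfl
    _ = _ := by rw [Finset.prod_const, Finset.card_univ, Fintype.card_fin]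

theorem card_weightFinset_mul_pow_le {n i : ℕ} {θ : ℝ} (h0 : 0 ≤ θ) :
    ((weightFinset n i).card : ℝ) * θ ^ i ≤ (1 + θ) ^ n := by
  calc _ = ∑ v ∈ weightFinset n i, ∏ b, (if v b = 0 then 1 else θ) := by
        rw [← nsmul_eq_mul, ← Finset.sum_const]
        refine Finset.sum_congr rfl fun v hv => ?_
        rw [← pow_hammingNorm_eq_prod, mem_weightFinset.1 hv]
    _ ≤ ∑ v : Fin n → ZMod 2, ∏ b, (if v b = 0 then 1 else θ) := by
        refine Finset.sum_le_sum_of_subset_of_nonneg (Finset.subset_univ _) fun v _ _ => ?_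
        exact Finset.prod_nonneg fun b _ => by split_ifs <;> linarith
    _ = _ := by
        rw [sum_pi_prod fun _ x => if x = 0 then (1 : ℝ) else θ]
        simp [sum_zmod_two]

/-! ### Entropy, `psi` and the choice of the Chernoff parameter. -/

theorem two_rpow_entropyTwo {γ : ℝ} (h0 : 0 < γ) (h1 : γ < 1) :
    (2 : ℝ) ^ entropyTwo γ * (γ / (1 - γ)) ^ γ = 1 + γ / (1 - γ) := by
  have h1' : 0 < 1 - γ := by linarith
  have e : (2 : ℝ) ^ entropyTwo γ = Real.exp (-(γ * Real.log γ) - (1 - γ) * Real.log (1 - γ)) := by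
    rw [Real.rpow_def_of_pos two_pos, entropyTwo]
    congr 1
    simp only [Real.logb, one_div, Real.log_inv]
    have := (Real.log_pos one_lt_two).ne'
    field_simp
    ring
  have e2 : 1 + γ / (1 - γ) = Real.exp (-Real.log (1 - γ)) := by
    rw [Real.exp_neg, Real.exp_log h1']
    field_simp
    ring
  rw [e, e2, Real.rpow_def_of_pos (div_pos h0 h1'), ← Real.exp_add,
    Real.log_div h0.ne' h1'.ne']
  congr 1
  ring

/-- Weighted AM-GM for `θ / γ` and `1 / (1 - γ)` with weights `γ` and `1 - γ`. The previous lemma is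
the equality case `θ = γ / (1 - γ)`. -/
theorem two_rpow_entropyTwo_mul_rpow_le {γ θ : ℝ} (h0 : 0 < γ) (h1 : γ < 1) (hθ : 0 ≤ θ) :
    (2 : ℝ) ^ entropyTwo γ * θ ^ γ ≤ 1 + θ := by
  have h1' : 0 < 1 - γ := by linarith
  have h := Real.geom_mean_le_arith_mean2_weighted h0.le h1'.le
    (div_nonneg hθ h0.le) (one_div_nonneg.2 h1'.le) (by ring)
  have e : (2 : ℝ) ^ entropyTwo γ = (γ ^ γ)⁻¹ * ((1 - γ) ^ (1 - γ))⁻¹ := by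
    have := two_rpow_entropyTwo h0 h1
    rw [Real.div_rpow h0.le h1'.le] at this
    have hg := Real.rpow_pos_of_pos h0 γ
    have hg1 := Real.rpow_pos_of_pos h1' γ
    rw [Real.rpow_sub h1', Real.rpow_one]
    field_simp at this ⊢
    linarith
  rw [e]
  rw [Real.div_rpow hθ h0.le, Real.div_rpow zero_le_one h1'.le, Real.one_rpow] at h
  calc _ = θ ^ γ / γ ^ γ * (1 / (1 - γ) ^ (1 - γ)) := by ring
    _ ≤ _ := h
    _ = 1 + θ := by field_simp; ring

theorem entropyTwo_le_one {γ : ℝ} (h0 : 0 < γ) (h1 : γ < 1) : entropyTwo γ ≤ 1 := by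
  have h := two_rpow_entropyTwo_mul_rpow_le h0 h1 zero_le_one
  rw [Real.one_rpow, mul_one] at h
  exact (Real.rpow_le_rpow_left_iff one_lt_two).1 (by rw [Real.rpow_one]; linarith)

theorem entropyTwo_eq_binEntropy (γ : ℝ) : entropyTwo γ = Real.binEntropy γ / Real.log 2 := by
  simp only [entropyTwo, Real.binEntropy, Real.logb, one_div]
  ring

theorem exists_entropyTwo_lt {η : ℝ} (hη : 0 < η) :
    ∃ γ₀ : ℝ, 0 < γ₀ ∧ γ₀ < 1 / 2 ∧ ∀ γ, 0 < γ → γ < γ₀ → entropyTwo γ < η := by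
  have hc : Continuous entropyTwo := by
    have : entropyTwo = fun γ => Real.binEntropy γ / Real.log 2 :=
      funext entropyTwo_eq_binEntropy
    rw [this]
    exact Real.binEntropy_continuous.div_const _
  have h := hc.tendsto 0
  rw [show entropyTwo 0 = 0 by simp [entropyTwo]] at h
  obtain ⟨r, hr, hlt⟩ := Metric.eventually_nhds_iff.1 (h.eventually (gt_mem_nhds hη))
  refine ⟨min r (1 / 4), by positivity, by linarith [min_le_right r (1 / 4)], fun γ h0 h1 => ?_⟩
  exact hlt (by rw [Real.dist_eq, sub_zero, abs_of_pos h0]; exact h1.trans_le (min_le_left _ _))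

/-- A uniform bound for `1 + (1 - 2γ)^a` when the entropy of `γ` is bounded from below. -/
theorem exists_one_add_pow_le {η ρ : ℝ} (hη : 0 < η) (hρ : 0 < ρ) :
    ∃ T : ℕ, 0 < T ∧ ∀ γ : ℝ, 0 < γ → γ < 1 / 2 → η ≤ entropyTwo γ → ∀ a : ℕ, T ≤ a →
      1 + (1 - 2 * γ) ^ a ≤ (2 : ℝ) ^ ρ := by
  obtain ⟨γ₀, h0, h1, hlt⟩ := exists_entropyTwo_lt hη
  have hpos : 0 < (2 : ℝ) ^ ρ - 1 := by
    have := Real.one_lt_rpow one_lt_two hρ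
    linarith
  obtain ⟨T, hT⟩ := exists_pow_lt_of_lt_one hpos (show 1 - 2 * γ₀ < 1 by linarith)
  -- The extra `1` only makes the threshold positive.
  refine ⟨T + 1, Nat.succ_pos _, fun γ hγ hγ2 hent a ha => ?_⟩
  have hge : γ₀ ≤ γ := by
    by_contra! h
    exact absurd (hlt γ hγ h) (not_lt.2 hent)
  have : (1 - 2 * γ) ^ a ≤ (1 - 2 * γ₀) ^ T :=
    calc (1 - 2 * γ) ^ a ≤ (1 - 2 * γ) ^ T :=
          pow_le_pow_of_le_one (by linarith) (by linarith) (by omega)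
      _ ≤ _ := pow_le_pow_left₀ (by linarith) (by linarith) _
  linarith

theorem pow_eq_rpow_pow {θ γ : ℝ} {n i : ℕ} (hθ : 0 ≤ θ) (hi : (i : ℝ) = γ * n) :
    θ ^ i = (θ ^ γ) ^ n := by
  rw [← Real.rpow_natCast, hi, Real.rpow_mul hθ, Real.rpow_natCast]

theorem card_weightFinset_le {γ : ℝ} {n i : ℕ} (h0 : 0 < γ) (h1 : γ < 1)
    (hi : (i : ℝ) = γ * n) :
    ((weightFinset n i).card : ℝ) ≤ (2 : ℝ) ^ (entropyTwo γ * n) := by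
  have hθ : 0 < γ / (1 - γ) := div_pos h0 (by linarith)
  have h := card_weightFinset_mul_pow_le (n := n) (i := i) hθ.le
  rw [← two_rpow_entropyTwo h0 h1, mul_pow, pow_eq_rpow_pow hθ.le hi] at h
  rw [Real.rpow_mul two_pos.le, Real.rpow_natCast]
  exact le_of_mul_le_mul_right h (by positivity)

/-- Take `θ = γ / (1 - γ)`, optimal for a single vector. Then `1 - θ = (1 + θ) * (1 - 2 * γ)`, so
the sum constraint saves `2 ^ n` up to the correction from `(1 - 2γ) ^ |α|`. -/
theorem card_filter_sum_eq_le {α : Type*} [Fintype α] [DecidableEq α] {γ : ℝ} {n i : ℕ}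
    (h0 : 0 < γ) (h1 : γ < 1 / 2) (hi : (i : ℝ) = γ * n) (w : Fin n → ZMod 2) :
    (((Fintype.piFinset fun _ : α => weightFinset n i).filter fun V => ∑ j, V j = w).card : ℝ) ≤
      (2 : ℝ) ^ (entropyTwo γ * n * Fintype.card α - n) *
        (1 + (1 - 2 * γ) ^ Fintype.card α) ^ n := by
  have h1' : 0 < 1 - γ := by linarith
  have hθ : 0 < γ / (1 - γ) := div_pos h0 h1'
  have hθ1 : γ / (1 - γ) ≤ 1 := by rw [div_le_one h1']; linarith
  have h := card_filter_sum_eq_mul_pow_le (α := α) (n := n) (i := i) hθ.le hθ1 w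
  have e : 1 - γ / (1 - γ) = (1 + γ / (1 - γ)) * (1 - 2 * γ) := by
    field_simp; ring
  set a := Fintype.card α
  have e2 : (((1 + γ / (1 - γ)) ^ a + (1 - γ / (1 - γ)) ^ a) / 2) ^ n =
      ((2 : ℝ) ^ (entropyTwo γ * n * a - n) * (1 + (1 - 2 * γ) ^ a) ^ n) *
        (γ / (1 - γ)) ^ (i * a) := by
    rw [e, mul_pow _ (1 - 2 * γ), ← two_rpow_entropyTwo h0 (by linarith), pow_mul, pow_eq_rpow_pow hθ.le hi,
      Real.rpow_sub two_pos, Real.rpow_mul two_pos.le, Real.rpow_mul two_pos.le,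
      Real.rpow_natCast, Real.rpow_natCast, Real.rpow_natCast, ← pow_mul, ← pow_mul,
      mul_comm n a, pow_mul, pow_mul, ← mul_pow, ← div_pow, ← mul_pow, ← mul_pow]
    congr 1
    simp only [mul_pow]
    ring
  rw [e2] at h
  exact le_of_mul_le_mul_right h (by positivity)

/-- With `θ = 1 - 2δ` one has `1 + θ = 2(1 - δ)` and `1 - θ = 2δ`, so `psi` is by design the
exponent of the Chernoff bound at this parameter. -/
theorem exists_two_rpow_psi_mul_pow {γ : ℝ} {n i k : ℕ} (h0 : 0 < γ) (h1 : γ < 1 / 2)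
    (hi : (i : ℝ) = γ * n) (hk : 2 ≤ k) :
    ∃ θ : ℝ, 0 < θ ∧ θ ≤ 1 ∧
      (2 : ℝ) ^ ((psi k γ + (k : ℝ) / 2 * entropyTwo γ) * n) * θ ^ (i * k) =
        (((1 + θ) ^ k + (1 - θ) ^ k) / 2) ^ n := by
  obtain ⟨⟨hd0, hd1⟩, hd⟩ := psiDelta_spec (p := k) (x := γ) (by exact_mod_cast hk) h0 h1
  set δ := psiDelta k γ with hδ
  -- The defining equation of `δ` is needed only here, to make `θ` positive.
  have hne : δ ≠ 1 / 2 := by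
    intro h
    rw [h] at hd
    simp only [psiParam, sub_self, zero_mul] at hd
    linarith
  have hlt : δ < 1 / 2 := lt_of_le_of_ne hd1 hne
  have hθ : 0 < 1 - 2 * δ := by linarith
  refine ⟨1 - 2 * δ, hθ, by linarith, ?_⟩
  have hpos : 0 < (1 - δ) ^ k + δ ^ k :=
    add_pos_of_pos_of_nonneg (pow_pos (by linarith) _) (pow_nonneg hd0 _)
  have e : psi k γ + (k : ℝ) / 2 * entropyTwo γ =
      k - 1 + Real.logb 2 ((1 - δ) ^ k + δ ^ k) - Real.logb 2 (1 - 2 * δ) * (γ * k) := by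
    rw [psi, ← hδ, Real.rpow_natCast, Real.rpow_natCast]
    ring
  have e1 : (2 : ℝ) ^ (psi k γ + (k : ℝ) / 2 * entropyTwo γ) =
      2 ^ k / 2 * ((1 - δ) ^ k + δ ^ k) / ((1 - 2 * δ) ^ γ) ^ k := by
    rw [e, Real.rpow_sub two_pos, Real.rpow_add two_pos, Real.rpow_sub two_pos,
      Real.rpow_mul two_pos.le, Real.rpow_logb two_pos (by norm_num) hpos,
      Real.rpow_logb two_pos (by norm_num) hθ, Real.rpow_mul hθ.le, Real.rpow_natCast,
      Real.rpow_natCast, Real.rpow_one]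
  rw [Real.rpow_mul two_pos.le, Real.rpow_natCast, e1, pow_mul, pow_eq_rpow_pow hθ.le hi,
    ← pow_mul, mul_comm n k, pow_mul, ← mul_pow]
  congr 1
  have hp : 0 < ((1 - 2 * δ) ^ γ) ^ k := by positivity
  rw [div_mul_cancel₀ _ hp.ne', show 1 + (1 - 2 * δ) = 2 * (1 - δ) by ring,
    show 1 - (1 - 2 * δ) = 2 * δ by ring, mul_pow, mul_pow]
  ring

theorem card_filter_sum_eq_le_psi {γ : ℝ} {n i k : ℕ} (h0 : 0 < γ) (h1 : γ < 1 / 2)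
    (hi : (i : ℝ) = γ * n) (hk : 2 ≤ k) (w : Fin n → ZMod 2) :
    (((Fintype.piFinset fun _ : Fin k => weightFinset n i).filter
      fun V => ∑ j, V j = w).card : ℝ) ≤
      (2 : ℝ) ^ ((psi k γ + (k : ℝ) / 2 * entropyTwo γ) * n) := by
  obtain ⟨θ, hθ0, hθ1, e⟩ := exists_two_rpow_psi_mul_pow h0 h1 hi hk
  have h := card_filter_sum_eq_mul_pow_le (α := Fin k) (n := n) (i := i) hθ0.le hθ1 w
  rw [Fintype.card_fin, ← e] at h
  exact le_of_mul_le_mul_right h (by positivity)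

/-- Discard `(1 - θ) ^ k` from the Chernoff expression and bound `1 + θ` below by the entropy
inequality. This lets the target absorb the non-constant tuples. -/
theorem two_rpow_le_two_rpow_psi {γ : ℝ} {n i k : ℕ} (h0 : 0 < γ) (h1 : γ < 1 / 2)
    (hi : (i : ℝ) = γ * n) (hk : 2 ≤ k) :
    (2 : ℝ) ^ (entropyTwo γ * n * k - n) ≤
      (2 : ℝ) ^ ((psi k γ + (k : ℝ) / 2 * entropyTwo γ) * n) := by
  obtain ⟨θ, hθ0, hθ1, e⟩ := exists_two_rpow_psi_mul_pow h0 h1 hi hk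
  have hpos : 0 < θ ^ (i * k) := by positivity
  refine le_of_mul_le_mul_right ?_ hpos
  rw [e, pow_mul, pow_eq_rpow_pow hθ0.le hi,
      Real.rpow_sub two_pos, Real.rpow_mul two_pos.le, Real.rpow_mul two_pos.le,
      Real.rpow_natCast, Real.rpow_natCast, Real.rpow_natCast, ← pow_mul, ← pow_mul,
      mul_comm n k, pow_mul, pow_mul, ← div_pow, ← mul_pow]
  refine pow_le_pow_left₀ (by positivity) ?_ _
  have h2 := pow_le_pow_left₀ (by positivity)
    (two_rpow_entropyTwo_mul_rpow_le h0 (by linarith) hθ0.le) k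
  rw [mul_pow] at h2
  have h3 : 0 ≤ (1 - θ) ^ k := pow_nonneg (by linarith) _
  linarith

/-! ### Relation counts according to rank. -/

theorem relationCount_le_of_const {E : Type*} [AddCommGroup E] [Module (ZMod 2) E]
    [DecidableEq E] {n k : ℕ} (L : Finset (Fin n → ZMod 2)) {u : E} (hu : u ≠ 0) :
    relationCount L (fun _ : Fin k => u) ≤
      ((Fintype.piFinset fun _ : Fin k => L).filter fun V => ∑ j, V j = 0).card := by
  refine Finset.card_le_card fun V hV => ?_
  rw [Finset.mem_filter] at hV ⊢
  refine ⟨hV.1, ?_⟩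
  ext b
  have := hV.2 b
  rw [← Finset.sum_smul] at this
  rw [Finset.sum_apply]
  exact (smul_eq_zero.1 this).resolve_right hu

/-- The bound for relation counts of families of rank `d`: either the family has many equal
members, or `d` is large. -/
theorem relationCount_le {E : Type*} [AddCommGroup E] [Module (ZMod 2) E] [DecidableEq E]
    {γ ρ : ℝ} {n i k T D : ℕ} (h0 : 0 < γ) (h1 : γ < 1 / 2) (hi : (i : ℝ) = γ * n)
    (hT0 : 0 < T) (hT : ∀ a : ℕ, T ≤ a → 1 + (1 - 2 * γ) ^ a ≤ (2 : ℝ) ^ ρ)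
    (hk : 2 ^ D * T ≤ k) (U : Fin k → E) (hU : ∀ j, U j ≠ 0) {d : ℕ}
    (hd : Module.finrank (ZMod 2) (Submodule.span (ZMod 2) (Set.range U)) = d) :
    (relationCount (weightFinset n i) U : ℝ) ≤
        (2 : ℝ) ^ (entropyTwo γ * n * (k + 1 - d) - n + ρ * n) ∨
      D < d ∧ (relationCount (weightFinset n i) U : ℝ) ≤
        (2 : ℝ) ^ (entropyTwo γ * n * (k - d)) := by
  have hkpos : 0 < k := lt_of_lt_of_le (by positivity) hk
  have : Nonempty (Fin k) := ⟨⟨0, hkpos⟩⟩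
  have hB := card_weightFinset_le h0 (by linarith) hi
  rcases le_or_gt d D with hdD | hdD
  · left
    obtain ⟨j₀, hj₀⟩ := exists_le_card_fiber_of_finrank_span U (T := T) (by
      rw [hd, Fintype.card_fin]
      exact (Nat.mul_le_mul_right T (Nat.pow_le_pow_right two_pos hdD)).trans hk)
    set A := Finset.univ.filter fun j => U j = U j₀ with hA
    have hW : ∀ w : Fin n → ZMod 2, ((Fintype.piFinset fun _ : A => weightFinset n i).filter
        fun V => ∑ j, V j = w).card ≤
        ⌊(2 : ℝ) ^ (entropyTwo γ * n * A.card - n + ρ * n)⌋₊ := by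
      intro w
      refine Nat.le_floor ((card_filter_sum_eq_le h0 h1 hi w).trans ?_)
      rw [Fintype.card_coe, Real.rpow_add two_pos, Real.rpow_mul two_pos.le ρ, Real.rpow_natCast]
      have : 0 ≤ (1 - 2 * γ) ^ A.card := pow_nonneg (by linarith) _
      gcongr
      exact hT _ hj₀
    obtain ⟨s, hs, hle⟩ := exists_relationCount_le (weightFinset n i) U (A := A) (hU j₀)
      (fun j hj => (Finset.mem_filter.1 hj).2) ⟨j₀, by simp [hA]⟩ hW
    have hs' : (s : ℝ) + A.card + d = k + 1 := by
      rw [hd, Fintype.card_fin] at hs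
      exact_mod_cast hs
    calc (relationCount (weightFinset n i) U : ℝ)
        ≤ ⌊(2 : ℝ) ^ (entropyTwo γ * n * A.card - n + ρ * n)⌋₊ *
            ((weightFinset n i).card : ℝ) ^ s := by exact_mod_cast hle
      _ ≤ (2 : ℝ) ^ (entropyTwo γ * n * A.card - n + ρ * n) *
            ((2 : ℝ) ^ (entropyTwo γ * n)) ^ s := by
          gcongr
          exact Nat.floor_le (by positivity)
      _ = _ := by
          rw [← Real.rpow_natCast _ s, ← Real.rpow_mul two_pos.le, ← Real.rpow_add two_pos]
          congr 1
          linear_combination (entropyTwo γ * n) * hs'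
  · right
    refine ⟨hdD, ?_⟩
    obtain ⟨j₀⟩ := this
    -- For a one-element block the sum determines the vector, so `W = 1` and only the rank saves.
    have hW : ∀ w : Fin n → ZMod 2,
        ((Fintype.piFinset fun _ : ({j₀} : Finset (Fin k)) => weightFinset n i).filter
          fun V => ∑ j, V j = w).card ≤ 1 := by
      intro w
      refine Finset.card_le_one.2 fun V hV V' hV' => ?_
      have h := (Finset.mem_filter.1 hV).2.trans (Finset.mem_filter.1 hV').2.symm
      rw [Fintype.sum_unique, Fintype.sum_unique] at h
      ext j : 1
      rwa [Subsingleton.elim j default]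
    obtain ⟨s, hs, hle⟩ := exists_relationCount_le (weightFinset n i) U (A := {j₀}) (hU j₀)
      (fun j hj => by rw [Finset.mem_singleton.1 hj]) ⟨j₀, by simp⟩ hW
    have hs' : (s : ℝ) = k - d := by
      rw [hd, Fintype.card_fin, Finset.card_singleton] at hs
      have : s + d = k := by omega
      rw [← this]; push_cast; ring
    rw [one_mul] at hle
    calc (relationCount (weightFinset n i) U : ℝ)
        ≤ ((weightFinset n i).card : ℝ) ^ s := by exact_mod_cast hle
      _ ≤ ((2 : ℝ) ^ (entropyTwo γ * n)) ^ s := by gcongr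
      _ = _ := by
          rw [← Real.rpow_natCast _ s, ← Real.rpow_mul two_pos.le, hs']

/-! ### Summation over all tuples and conclusion. -/

theorem sum_relationCount_const_le {γ : ℝ} {n i m k : ℕ} (h0 : 0 < γ) (h1 : γ < 1 / 2)
    (hi : (i : ℝ) = γ * n) (hk : 2 ≤ k) :
    ∑ U ∈ (Fintype.piFinset fun _ : Fin k => Finset.univ.erase (0 : Fin m → ZMod 2)).filter
      (fun U => ∀ a b, U a = U b), (relationCount (weightFinset n i) U : ℝ) ≤
      2 ^ m * (2 : ℝ) ^ ((psi k γ + (k : ℝ) / 2 * entropyTwo γ) * n) := by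
  have j₀ : Fin k := ⟨0, by omega⟩
  have hcard : ((Fintype.piFinset fun _ : Fin k => Finset.univ.erase (0 : Fin m → ZMod 2)).filter
      (fun U => ∀ a b, U a = U b)).card ≤ 2 ^ m := by
    have : (Finset.univ : Finset (Fin m → ZMod 2)).card = 2 ^ m := by simp
    rw [← this]
    refine Finset.card_le_card_of_injOn (fun U => U j₀)
      (fun _ _ => Finset.mem_coe.2 (Finset.mem_univ _)) ?_
    intro U hU U' hU' h
    have h1 := (Finset.mem_filter.1 (Finset.mem_coe.1 hU)).2
    have h2 := (Finset.mem_filter.1 (Finset.mem_coe.1 hU')).2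
    ext j : 1
    rw [h1 j j₀, h2 j j₀]
    exact h
  refine (Finset.sum_le_card_nsmul _ _
    ((2 : ℝ) ^ ((psi k γ + (k : ℝ) / 2 * entropyTwo γ) * n)) fun U hU => ?_).trans ?_
  · rw [Finset.mem_filter, Fintype.mem_piFinset] at hU
    have hc : U = fun _ => U j₀ := funext fun j => hU.2 j j₀
    rw [hc]
    refine le_trans ?_ (card_filter_sum_eq_le_psi h0 h1 hi hk 0)
    exact_mod_cast relationCount_le_of_const _ (Finset.ne_of_mem_erase (hU.1 j₀))
  · rw [nsmul_eq_mul]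
    gcongr
    exact_mod_cast hcard

theorem sum_relationCount_not_const_le {ε γ lam : ℝ} {n i m k T D : ℕ} (hε : 0 < ε)
    (h0 : 0 < γ) (h1 : γ < 1 / 2) (hlam : ε ≤ lam) (hent : lam + ε ≤ entropyTwo γ)
    (hi : (i : ℝ) = γ * n) (hm : (m : ℝ) = lam * n) (hT0 : 0 < T)
    (hT : ∀ a : ℕ, T ≤ a → 1 + (1 - 2 * γ) ^ a ≤ (2 : ℝ) ^ (ε / 2))
    (hD : 2 / ε ≤ D) (hk : 2 ^ D * T ≤ k) (hkn : (k : ℝ) ≤ ε / 8 * n) :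
    ∑ U ∈ (Fintype.piFinset fun _ : Fin k => Finset.univ.erase (0 : Fin m → ZMod 2)).filter
      (fun U => ¬ ∀ a b, U a = U b), (relationCount (weightFinset n i) U : ℝ) ≤
      2 * 2 ^ m * (2 : ℝ) ^ (entropyTwo γ * n * k - n) := by
  classical
  set P := (Fintype.piFinset fun _ : Fin k => Finset.univ.erase (0 : Fin m → ZMod 2)).filter
      (fun U => ¬ ∀ a b, U a = U b) with hP
  have hPU : ∀ U ∈ P, (∀ j, U j ≠ 0) ∧
      2 ≤ Module.finrank (ZMod 2) (Submodule.span (ZMod 2) (Set.range U)) := by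
    intro U hU
    rw [hP, Finset.mem_filter, Fintype.mem_piFinset] at hU
    have hne : ∀ j, U j ≠ 0 := fun j => Finset.ne_of_mem_erase (hU.1 j)
    obtain ⟨h, hc⟩ := hU
    push Not at hc
    obtain ⟨a, b, hab⟩ := hc
    exact ⟨hne, one_lt_finrank_span_of_ne hne hab⟩
  have hmaps : ∀ U ∈ P, Module.finrank (ZMod 2) (Submodule.span (ZMod 2) (Set.range U)) ∈
      Finset.range (k + 1) := by
    intro U _
    rw [Finset.mem_range, Nat.lt_succ_iff]
    simpa [Set.finrank] using finrank_range_le_card (R := ZMod 2) U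
  have hk1 : (1 : ℝ) ≤ k := by
    exact_mod_cast (Nat.succ_le_of_lt (by positivity : 0 < 2 ^ D * T)).trans hk
  have hle1 := entropyTwo_le_one h0 (by linarith)
  rw [← Finset.sum_fiberwise_of_maps_to hmaps]
  have hrank : ∀ d ∈ Finset.range (k + 1),
      ∑ U ∈ P.filter (fun U =>
        Module.finrank (ZMod 2) (Submodule.span (ZMod 2) (Set.range U)) = d),
        (relationCount (weightFinset n i) U : ℝ) ≤
        (1 / 2) ^ d * (2 ^ m * (2 : ℝ) ^ (entropyTwo γ * n * k - n)) := by
    intro d _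
    rcases lt_or_ge d 2 with hd | hd
    · rw [Finset.filter_eq_empty_iff.2, Finset.sum_empty]
      · positivity
      · intro U hU h
        have := (hPU U hU).2
        omega
    have hd' : (2 : ℝ) ≤ d := by exact_mod_cast hd
    -- The largest exponent allowed per tuple: the target minus the exponent `k d + λ n d` of the
    -- number of rank-`d` tuples, minus `d` more to make the sum over `d` geometric.
    set X : ℝ := lam * n + entropyTwo γ * n * k - n - d - (k * d + lam * n * d) with hX
    have hn : (0 : ℝ) ≤ n := Nat.cast_nonneg n
    -- From `4 k ≤ (ε / 2) n`, `d ≤ 2 (d - 1)` and `k ≥ 1`. So half of the entropy gap pays for the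
    -- coordinate count and the geometric factor.
    have hkd : (k : ℝ) * d + d ≤ (d - 1) * (ε / 2 * n) := by
      nlinarith [mul_le_mul_of_nonneg_left hkn (show (0 : ℝ) ≤ d - 1 by linarith),
        mul_nonneg (show (0 : ℝ) ≤ d - 2 by linarith) (show (0 : ℝ) ≤ k by linarith),
        mul_nonneg (show (0 : ℝ) ≤ d - 1 by linarith) (show (0 : ℝ) ≤ k - 1 by linarith)]
    have hgap : (d - 1) * (lam * n + ε * n) ≤ (d - 1) * (entropyTwo γ * n) := by
      have := mul_le_mul_of_nonneg_right hent hn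
      exact mul_le_mul_of_nonneg_left (by linarith) (by linarith)
    have hterm : ∀ U ∈ P.filter (fun U =>
        Module.finrank (ZMod 2) (Submodule.span (ZMod 2) (Set.range U)) = d),
        (relationCount (weightFinset n i) U : ℝ) ≤ (2 : ℝ) ^ X := by
      intro U hU
      rw [Finset.mem_filter] at hU
      rcases relationCount_le h0 h1 hi hT0 hT hk U (hPU U hU.1).1 hU.2 with h | ⟨hDd, h⟩
      · refine h.trans (Real.rpow_le_rpow_of_exponent_le one_le_two ?_)
        have : ε / 2 * n ≤ (d - 1) * (ε / 2 * n) :=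
          le_mul_of_one_le_left (by positivity) (by linarith)
        rw [hX]
        linarith
      · refine h.trans (Real.rpow_le_rpow_of_exponent_le one_le_two ?_)
        -- Since `d > D ≥ 2 / ε`, half of the gap `d ε n` already covers the missing factor `2 ^ n`.
        have hεd : 2 ≤ d * ε := by
          have : (D : ℝ) ≤ d := by exact_mod_cast hDd.le
          exact (div_le_iff₀ hε).1 (hD.trans this)
        have h2 : 2 * (n : ℝ) ≤ d * ε * n := mul_le_mul_of_nonneg_right hεd hn
        have h3 : (lam + ε) * n ≤ entropyTwo γ * n := mul_le_mul_of_nonneg_right hent hn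
        have h4 : ε * n ≤ lam * n := mul_le_mul_of_nonneg_right hlam hn
        have h5 : 0 ≤ ε * n := by positivity
        rw [hX]
        linarith
    refine (Finset.sum_le_card_nsmul _ _ _ hterm).trans ?_
    have hcard : ((P.filter (fun U =>
        Module.finrank (ZMod 2) (Submodule.span (ZMod 2) (Set.range U)) = d)).card : ℝ) ≤
        (2 : ℝ) ^ ((k : ℝ) * d + lam * n * d) := by
      have h := (Finset.card_le_card (Finset.filter_subset_filter _ (Finset.subset_univ P))).trans
        (card_filter_finrank_span_le (κ := Fin k) (E := Fin m → ZMod 2) d)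
      rw [Fintype.card_fin, Fintype.card_fun, ZMod.card, Fintype.card_fin, ← pow_mul,
        ← pow_add] at h
      rw [← hm]
      exact_mod_cast h
    rw [nsmul_eq_mul]
    refine (mul_le_mul_of_nonneg_right hcard (by positivity)).trans (le_of_eq ?_)
    rw [one_div, inv_pow, ← Real.rpow_natCast 2 d, ← Real.rpow_natCast 2 m,
      ← Real.rpow_neg two_pos.le, ← Real.rpow_add two_pos, ← Real.rpow_add two_pos,
      ← Real.rpow_add two_pos, hm, hX]
    congr 1
    ring
  refine (Finset.sum_le_sum hrank).trans ?_
  rw [← Finset.sum_mul, mul_assoc 2]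
  exact mul_le_mul_of_nonneg_right (sum_geometric_two_le _) (by positivity)

theorem proposition1p4 (ε : ℝ) (hε : 0 < ε) :
    ∃ c C : ℝ, 0 < c ∧ 0 < C ∧
    ∃ θ : ℕ → ℝ, Asymptotics.IsLittleO Filter.atTop θ (fun n : ℕ => (n : ℝ)) ∧
    ∀ γ lam : ℝ, 0 < γ → γ < 1 / 2 → 0 < lam → lam < entropyTwo γ →
      ε = min lam (entropyTwo γ - lam) →
    ∀ n i m k : ℕ, (i : ℝ) = γ * n → Even i → (m : ℝ) = lam * n →
      C ≤ (k : ℝ) → (k : ℝ) ≤ c * n →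
      centralMoment m n i k ≤
        (2 : ℝ) ^ θ n *
          (((2 : ℝ) ^ (-(lam * n))) ^ (k - 1) *
            (2 : ℝ) ^ ((psi k γ + (k : ℝ) / 2 * entropyTwo γ) * n)) := by
  obtain ⟨T, hT0, hT⟩ := exists_one_add_pow_le (η := ε) (ρ := ε / 2) hε (by positivity)
  set D := ⌈2 / ε⌉₊ with hD
  -- `2 ^ D * T` is what pigeonhole needs up to rank `D`, and `+ 2` gives `k ≥ 2` for `psi`. The
  -- constant exponent `2` is a factor `4`, covering `1` from constant tuples and `2` from the
  -- others.
  refine ⟨ε / 8, 2 ^ D * T + 2, by positivity, by positivity, fun _ => 2, ?_, ?_⟩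
  · rw [Asymptotics.isLittleO_const_left]
    right
    exact tendsto_norm_atTop_atTop.comp tendsto_natCast_atTop_atTop
  intro γ lam h0 h1 hlam0 _ hmin n i m k hi _ hm hCk hkn
  have hlam : ε ≤ lam := hmin.le.trans (min_le_left _ _)
  have hent : lam + ε ≤ entropyTwo γ := by
    linarith [hmin.le.trans (min_le_right lam (entropyTwo γ - lam))]
  have hk : 2 ^ D * T + 2 ≤ k := by exact_mod_cast hCk
  have hk2 : 2 ≤ k := le_trans (Nat.le_add_left _ _) hk
  have hn : (0 : ℝ) < n := by
    have : (0 : ℝ) < k := by exact_mod_cast (by omega : 0 < k)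
    by_contra! h
    have := mul_nonpos_of_nonneg_of_nonpos (show 0 ≤ ε / 8 by positivity) h
    linarith
  have hipos : 0 < i := by
    have : (0 : ℝ) < i := hi ▸ mul_pos h0 hn
    exact_mod_cast this
  have hconst := sum_relationCount_const_le (m := m) h0 h1 hi hk2
  have hrest := sum_relationCount_not_const_le hε h0 h1 hlam hent hi hm hT0
    (hT γ h0 h1 (by linarith)) (Nat.le_ceil _) (le_trans (Nat.le_add_right _ _) hk) hkn
  have hmain := two_rpow_le_two_rpow_psi h0 h1 hi hk2
  set Q := (2 : ℝ) ^ ((psi k γ + (k : ℝ) / 2 * entropyTwo γ) * n) with hQ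
  have hQ0 : 0 < Q := by positivity
  rw [centralMoment_eq hipos, ← Finset.sum_filter_add_sum_filter_not _
    (fun U : Fin k → Fin m → ZMod 2 => ∀ a b, U a = U b)]
  have hp : (2 : ℝ) ^ (-(lam * n)) = (2 ^ m : ℝ)⁻¹ := by
    rw [← hm, Real.rpow_neg two_pos.le, Real.rpow_natCast]
  have hN : (0 : ℝ) < 2 ^ m := by positivity
  have hsum : ∀ a b : ℝ, a ≤ 2 ^ m * Q →
      b ≤ 2 * 2 ^ m * (2 : ℝ) ^ (entropyTwo γ * n * k - n) → a + b ≤ 2 ^ m * (4 * Q) := by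
    intro a b ha hb
    have := mul_le_mul_of_nonneg_left hmain (show (0 : ℝ) ≤ 2 * 2 ^ m by positivity)
    nlinarith [mul_pos hN hQ0]
  refine (mul_le_mul_of_nonneg_left (hsum _ _ hconst hrest) (by positivity)).trans (le_of_eq ?_)
  obtain ⟨k, rfl⟩ : ∃ k', k = k' + 1 := ⟨k - 1, by omega⟩
  rw [hp, Nat.add_sub_cancel, pow_succ, show (2 : ℝ) ^ (2 : ℝ) = 4 by norm_num]
  field_simp
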